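/- **Model.** Consider $N\ge 1$ servers, each with an infinite queue, in discrete time. The number $A_\Sigma(t)$ of tasks arriving in a time slot is an integer-valued random variable, i.i.d. over slots. The service $S_n(t)$ offered by server $n$ is an integer-valued random variable, i.i.d. over slots, independent across servers and independent of the arrivals. For constants $S_{\max},A_{\max}<\infty$ we have $0\le S_n(t)\le S_{\max}$ for all $n$ and $0\le A_\Sigma(t)\le A_{\max}$. Let $\mu_n=\mathbb E[S_n(t)]>0$ and $\mu_\Sigma=\sum_n\mu_n$. The systems are indexed by $\epsilon\in(0,\mu_\Sigma)$: the service laws and the constants $S_{\max},A_{\max}$ do not depend on $\epsilon$, while $\mathbb E[A^{(\epsilon)}_\Sigma(t)]=\mu_\Sigma-\epsilon$ and $\mathbb P(A^{(\epsilon)}_\Sigma(t)=0)>0$. **Join-Below-Threshold (JBT) policy with threshold $r$.** The state is $Z(t)=(\mathbf Q(t),m(t))$, where $\mathbf Q(t)\in\mathbb Z_{\ge 0}^N$ is the vector of queue lengths and $m(t)\subseteq\{1,\dots,N\}$ is the set of server IDs in the dispatcher's memory. In slot $t$ all arrivals are sent to one server $i$, chosen (independently of the arrivals and the services of the slot, given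 $Z(t)$) with probability $\mu_i/\sum_{j\in m(t)}\mu_j$ among $i\in m(t)$ if $m(t)\neq\emptyset$, and with probability $\mu_i/\mu_\Sigma$ among all servers if $m(t)=\emptyset$. If there was an arrival, the ID of the chosen server is removed from the memory. The queues evolve by $Q_n(t+1)=\max\{Q_n(t)+A_n(t)-S_n(t),0\}$, with $A_i(t)=A_\Sigma(t)$ for the chosen server $i$ and $A_n(t)=0$ for $n\ne i$. At the end of the slot every server with $Q_n(t+1)<r$ whose ID is not in the memory sends its ID to it. Thus $Z(t)$ is a Markov chain. For $r\ge 0$ let $$\mathcal R^{(r)}=\{\mathbf x\in\mathbb R_+^N: x_n\le r\ \ \forall n\}\ \cup\ \{\mathbf x\in\mathbb R_+^N: x_n\ge r\ \ \forall n\},$$ and let $d_{\mathcal R^{(r)}}(\mathbf x)=\inf_{\mathbf y\in\mathcal R^{(r)}}\|\mathbf x-\mathbf y\|$ be the Euclidean distance to it. **Proposition 1.** Let the threshold of the $\epsilon$-th system be $r^{(\epsilon)}\in\mathbb R$, with $\lim_{\epsilon\downarrow0}r^{(\epsilon)}=\infty$. Then the state space of the JBT system collapses to $\mathcal R^{(r)}$: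 there are positive constants $\epsilon_0,\theta^*,C^*$, with $\theta^*$ and $C^*$ independent of $\epsilon$, such that for every $\epsilon\in(0,\epsilon_0)$ the chain $Z^{(\epsilon)}(t)$ has a unique stationary distribution, and the queue length vector $\overline{\mathbf Q}^{(\epsilon)}$ under this distribution satisfies $$\mathbb E\Big[e^{\theta^* d_{\mathcal R^{(r^{(\epsilon)})}}(\overline{\mathbf Q}^{(\epsilon)})}\Big]\le C^*.$$ -/

import Mathlib

open Filter Topology
open scoped ENNReal

noncomputable section

namespace JBT

/-- The mean of a law on the natural numbers (all laws below have finite support). -/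
def mean (p : PMF ℕ) : ℝ := ∑' k : ℕ, (k : ℝ) * (p k).toReal

/-- The primitive data of a family of load balancing systems with `N` servers, indexed by the
heavy-traffic parameter `ε`: the law of the service `S_n(t)` offered by each server, and the law
of the number `A_Σ(t)` of exogenous tasks in a time slot of the `ε`-th system. Only the arrival
law depends on `ε`; its mean is `μ_Σ - ε`. -/
structure Family (N : ℕ) where
  /-- there is at least one server -/
  servers_pos : 0 < N
  /-- the law of `S_n(t)` -/
  service : Fin N → PMF ℕ
  /-- the law of `A_Σ(t)` in the `ε`-th system -/
  arrival : ℝ → PMF ℕ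
  /-- bound on the offered service -/
  Smax : ℕ
  /-- bound on the number of arrivals, the same for all `ε` -/
  Amax : ℕ
  service_le : ∀ n k, Smax < k → service n k = 0
  service_mean_pos : ∀ n, 0 < mean (service n)
  arrival_le : ∀ ε : ℝ, 0 < ε → ε < ∑ n, mean (service n) → ∀ k, Amax < k → arrival ε k = 0
  arrival_zero : ∀ ε : ℝ, 0 < ε → ε < ∑ n, mean (service n) → arrival ε 0 ≠ 0
  arrival_mean : ∀ ε : ℝ, 0 < ε → ε < ∑ n, mean (service n) →
    mean (arrival ε) = (∑ n, mean (service n)) - ε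

/-- The state `Z(t) = (Q(t), m(t))`: the queue lengths, and the set of the server IDs held in the
memory of the dispatcher. -/
abbrev State (N : ℕ) : Type := (Fin N → ℕ) × Finset (Fin N)

variable {N : ℕ}

namespace Family

/-- The service rate `μ_n`. -/
def rate (F : Family N) (n : Fin N) : ℝ := mean (F.service n)

/-- The joint law of the services `(S_1(t), …, S_N(t))`, independent across servers. -/
def jointService (F : Family N) : PMF (Fin N → ℕ) :=
  (MeasureTheory.Measure.pi fun n => (F.service n).toMeasure).toPMF

/-- The servers that may be chosen: those in memory, or all of them if the memory is empty. -/
def candidates (m : Finset (Fin N)) : Finset (Fin N) :=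
  if m.Nonempty then m else Finset.univ

/-- The unnormalised dispatching weights. -/
def weight (F : Family N) (m : Finset (Fin N)) (i : Fin N) : ℝ≥0∞ :=
  if i ∈ candidates m then ENNReal.ofReal (F.rate i) else 0

theorem weight_ne_zero (F : Family N) (m : Finset (Fin N)) : ∑' i, F.weight m i ≠ 0 := by
  have h : ∃ i, i ∈ candidates m := by
    unfold candidates
    split_ifs with hm
    · exact hm
    · exact ⟨⟨0, F.servers_pos⟩, Finset.mem_univ _⟩
  obtain ⟨i, hi⟩ := h
  intro h0
  have h1 := ENNReal.tsum_eq_zero.1 h0 i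
  have h2 : 0 < F.rate i := F.service_mean_pos i
  rw [weight, if_pos hi, ENNReal.ofReal_eq_zero] at h1
  exact absurd h1 (not_le.2 h2)

theorem weight_ne_top (F : Family N) (m : Finset (Fin N)) : ∑' i, F.weight m i ≠ ∞ := by
  rw [tsum_fintype]
  refine ENNReal.sum_ne_top.2 fun i _ => ?_
  unfold weight
  split_ifs
  · exact ENNReal.ofReal_ne_top
  · exact ENNReal.zero_ne_top

/-- The law of the server to which the arrivals are sent, given the memory `m`: server `i` is
chosen with probability `μ_i / ∑_{j ∈ m} μ_j` if `i ∈ m`, and with probability `μ_i / μ_Σ` if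
`m` is empty. For equal service rates this is the uniform choice. -/
def dispatch (F : Family N) (m : Finset (Fin N)) : PMF (Fin N) :=
  PMF.normalize (F.weight m) (F.weight_ne_zero m) (F.weight_ne_top m)

/-- The queue lengths at the end of a slot, when `a` tasks arrive and are all sent to server `i`,
and `s` is the offered service. The subtraction of natural numbers is truncated at `0`, so this is
`Q_n + A_n - S_n + U_n` with the unused service `U_n = max (S_n - Q_n - A_n) 0`. -/
def nextQueue (q : Fin N → ℕ) (a : ℕ) (s : Fin N → ℕ) (i : Fin N) : Fin N → ℕ :=
  fun n => q n + (if n = i then a else 0) - s n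

/-- The memory at the end of a slot: if there were arrivals, the ID of the chosen server has been
removed; then every server whose queue length is below `r` and whose ID is not in memory sends
its ID. -/
def nextMemory (r : ℝ) (m : Finset (Fin N)) (a : ℕ) (i : Fin N) (q' : Fin N → ℕ) :
    Finset (Fin N) :=
  (if a = 0 then m else m.erase i) ∪ Finset.univ.filter fun n => (q' n : ℝ) < r

/-- One step of the Markov chain `Z(t)` of the `ε`-th system under Join-Below-Threshold with
threshold `r`. The arrivals, the services and the dispatching choice are drawn independently given
the current state. -/
def step (F : Family N) (ε r : ℝ) (z : State N) : PMF (State N) :=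
  (F.arrival ε).bind fun a =>
    F.jointService.bind fun s =>
      (F.dispatch z.2).bind fun i =>
        PMF.pure (nextQueue z.1 a s i, nextMemory r z.2 a i (nextQueue z.1 a s i))

/-- `π` is a steady-state (stationary) law of the chain. -/
def IsSteadyState (F : Family N) (ε r : ℝ) (π : PMF (State N)) : Prop :=
  π.bind (F.step ε r) = π

end Family

/-- The lower box `R_l = {x ∈ ℝ_+^N : x_n ≤ r for all n}`. -/
def lowerRegion (N : ℕ) (r : ℝ) : Set (EuclideanSpace ℝ (Fin N)) :=
  {x | ∀ n, 0 ≤ x n ∧ x n ≤ r}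

/-- The upper region `R_u = {x ∈ ℝ_+^N : x_n ≥ r for all n}`. -/
def upperRegion (N : ℕ) (r : ℝ) : Set (EuclideanSpace ℝ (Fin N)) :=
  {x | ∀ n, 0 ≤ x n ∧ r ≤ x n}

/-- `R = R_l ∪ R_u`. -/
def region (N : ℕ) (r : ℝ) : Set (EuclideanSpace ℝ (Fin N)) :=
  lowerRegion N r ∪ upperRegion N r

/-- The Euclidean distance of a queue length vector to the region `R`. -/
def distRegion (r : ℝ) (q : Fin N → ℕ) : ℝ :=
  Metric.infDist (WithLp.toLp 2 fun n => (q n : ℝ)) (region N r)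

/-- `E[exp (θ d_R(Q))]` when the state `(Q, m)` has law `π`. -/
def expMoment (r θ : ℝ) (π : PMF (State N)) : ℝ≥0∞ :=
  ∑' z : State N, π z * ENNReal.ofReal (Real.exp (θ * distRegion r z.1))

end JBT

end

/-!
The distance of `q` to the region is, up to a factor depending on `N`, the smaller of
`max_n (q_n - r)⁺` and `max_n (r - q_n)⁺`, so its exponential is dominated by the minimum of the
potentials `lowerPot = ∑ exp (θ (q_n - r)⁺)` and `upperPot = ∑ exp (θ (r - q_n)⁺)`.

Sums of exponentials are used, rather than the exponential of a norm, because they can be treated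
one queue at a time: `Family.lmean_step_contract` says that a term contracts, up to an additive
constant, as soon as the net input `A_n - S_n` has the right drift where the exponent is positive.
Started from the empty system, the memory always holds exactly the servers below the threshold
(`Family.consistent_closed`). Hence, if some server is below the threshold, the servers above it
receive nothing and `lowerPot` contracts; if some server is above it, the servers below share the
whole load, which exceeds their joint rate by at least `min μ_n - ε`, and `upperPot` contracts. Both
contract off the region, and in the region the smaller one does. So the minimum contracts with
constants that do not depend on `ε` (`Family.drift_min`), and its mean is bounded uniformly in time
and in `ε`.

If no server is below the threshold, each queue still has a drift of order `-ε`, so that for each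
fixed `ε` the potential `lowerPot`, with an exponent that depends on `ε`, contracts in all states
(`Family.drift_lowerPot`). Its sublevel sets are finite, hence the time averages of the law of the
chain are tight, a limit of them is invariant, and by Fatou's lemma the limit inherits the uniform
moment bound (`exists_invariant`). The invariant law is unique because the empty system can be
reached from every state: the minimum of two invariant laws is again invariant, and so are the two
excesses over it, one of which vanishes at the empty state (`invariant_unique`).
-/

open Filter Topology
open scoped ENNReal

noncomputable section

namespace JBT

/-! ### Expectations and invariant laws on a discrete space -/

section Discrete

variable {α β : Type*}

/-- The expectation of a nonnegative function under a discrete law. -/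
def lmean (p : PMF α) (f : α → ℝ≥0∞) : ℝ≥0∞ := ∑' x, p x * f x

theorem lmean_pure (x : α) (f : α → ℝ≥0∞) : lmean (PMF.pure x) f = f x := by
  classical
  unfold lmean
  rw [tsum_eq_single x]
  · simp
  · intro y hy
    simp [hy]

theorem lmean_bind (p : PMF α) (P : α → PMF β) (f : β → ℝ≥0∞) :
    lmean (p.bind P) f = lmean p fun x => lmean (P x) f := by
  simp only [lmean, PMF.bind_apply, ← ENNReal.tsum_mul_right, ← ENNReal.tsum_mul_left]
  rw [ENNReal.tsum_comm]
  simp only [mul_assoc]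

theorem lmean_const (p : PMF α) (c : ℝ≥0∞) : lmean p (fun _ => c) = c := by
  simp [lmean, ENNReal.tsum_mul_right, p.tsum_coe]

theorem lmean_add (p : PMF α) (f g : α → ℝ≥0∞) :
    lmean p (fun x => f x + g x) = lmean p f + lmean p g := by
  simp [lmean, mul_add, ENNReal.tsum_add]

theorem lmean_const_mul (p : PMF α) (c : ℝ≥0∞) (f : α → ℝ≥0∞) :
    lmean p (fun x => c * f x) = c * lmean p f := by
  simp [lmean, mul_left_comm, ENNReal.tsum_mul_left]

theorem lmean_mul_const (p : PMF α) (c : ℝ≥0∞) (f : α → ℝ≥0∞) :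
    lmean p (fun x => f x * c) = lmean p f * c := by
  simp [lmean, ← mul_assoc, ENNReal.tsum_mul_right]

theorem lmean_sum {ι : Type*} (s : Finset ι) (p : PMF α) (f : ι → α → ℝ≥0∞) :
    lmean p (fun x => ∑ n ∈ s, f n x) = ∑ n ∈ s, lmean p (f n) := by
  simp only [lmean, Finset.mul_sum]
  exact Summable.tsum_finsetSum fun _ _ => ENNReal.summable

theorem lmean_mono_of_support {p : PMF α} {f g : α → ℝ≥0∞} (h : ∀ x, p x ≠ 0 → f x ≤ g x) :
    lmean p f ≤ lmean p g := by
  refine ENNReal.tsum_le_tsum fun x => ?_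
  by_cases hx : p x = 0
  · simp [hx]
  · gcongr
    exact h x hx

theorem lmean_mono {p : PMF α} {f g : α → ℝ≥0∞} (h : ∀ x, f x ≤ g x) : lmean p f ≤ lmean p g :=
  lmean_mono_of_support fun x _ => h x

theorem eq_of_le_of_tsum_le {f g : α → ℝ≥0∞} (hle : ∀ x, f x ≤ g x) (hf : ∑' x, f x ≠ ∞)
    (hsum : ∑' x, g x ≤ ∑' x, f x) : f = g := by
  have h0 : ∑' x, (g x - f x) = 0 := by
    have h : ∑' x, f x + ∑' x, (g x - f x) = ∑' x, f x + 0 := by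
      rw [← ENNReal.tsum_add, add_zero]
      simp only [add_tsub_cancel_of_le (hle _)]
      exact le_antisymm hsum (ENNReal.tsum_le_tsum hle)
    exact (ENNReal.add_right_inj hf).1 h
  funext x
  exact le_antisymm (hle x) (tsub_eq_zero_iff_le.1 (ENNReal.tsum_eq_zero.1 h0 x))

theorem tsum_kernel (P : α → PMF α) (ν : α → ℝ≥0∞) : ∑' y, ∑' x, ν x * P x y = ∑' x, ν x := by
  rw [ENNReal.tsum_comm]
  simp [ENNReal.tsum_mul_left, PMF.tsum_coe]

theorem ne_zero_of_reachable {P : α → PMF α} {ν : α → ℝ≥0∞}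
    (hν : ∀ y, ∑' x, ν x * P x y = ν y) {x z : α}
    (h : Relation.ReflTransGen (fun x y => P x y ≠ 0) x z) (hx : ν x ≠ 0) : ν z ≠ 0 := by
  induction h with
  | refl => exact hx
  | @tail y z _ hyz ih =>
    rw [← hν z]
    intro h0
    exact mul_ne_zero ih hyz (ENNReal.tsum_eq_zero.1 h0 y)

/-- The excess of one invariant law over another is an invariant measure. If it vanishes at a state
that can be reached from everywhere, then it vanishes identically. -/
theorem eq_of_invariant_of_apply_le {P : α → PMF α} {z : α}
    (hz : ∀ x, Relation.ReflTransGen (fun x y => P x y ≠ 0) x z) {π π' : PMF α}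
    (h : π.bind P = π) (h' : π'.bind P = π') (hle : π z ≤ π' z) : π = π' := by
  have hπ : ∀ y, ∑' x, π x * P x y = π y := fun y => by rw [← PMF.bind_apply, h]
  have hπ' : ∀ y, ∑' x, π' x * P x y = π' y := fun y => by rw [← PMF.bind_apply, h']
  set ν : α → ℝ≥0∞ := fun x => min (π x) (π' x) with hνdef
  have hνfin : ∑' x, ν x ≠ ∞ :=
    ne_top_of_le_ne_top ENNReal.one_ne_top
      ((ENNReal.tsum_le_tsum fun x => min_le_left _ _).trans_eq π.tsum_coe)
  -- the minimum is superinvariant by monotonicity, hence invariant, as its mass is preserved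
  have hν : (fun y => ∑' x, ν x * P x y) = ν := by
    refine eq_of_le_of_tsum_le (fun y => le_min ?_ ?_) ?_ ?_
    · rw [← hπ y]
      exact ENNReal.tsum_le_tsum fun x => by gcongr; exact min_le_left _ _
    · rw [← hπ' y]
      exact ENNReal.tsum_le_tsum fun x => by gcongr; exact min_le_right _ _
    · rwa [tsum_kernel]
    · rw [tsum_kernel]
  have hadd : ∀ x, (π x - ν x) + ν x = π x := fun x => tsub_add_cancel_of_le (min_le_left _ _)
  have hinv : ∀ y, ∑' x, (π x - ν x) * P x y = π y - ν y := by
    intro y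
    have hy : ν y ≠ ∞ := ENNReal.ne_top_of_tsum_ne_top hνfin y
    refine (ENNReal.add_left_inj hy).1 ?_
    rw [hadd]
    conv_lhs => rw [← congrFun hν y]
    rw [← ENNReal.tsum_add]
    simp only [← add_mul, hadd]
    exact hπ y
  have hle' : ∀ x, π x ≤ π' x := by
    intro x
    by_contra hx
    refine ne_zero_of_reachable hinv (hz x) ?_ ?_
    · rw [hνdef]
      simp only [ne_eq, tsub_eq_zero_iff_le, le_min_iff, le_refl, true_and]
      exact hx
    · simp [hνdef, hle]
  exact DFunLike.coe_injective (eq_of_le_of_tsum_le hle' (by simp [π.tsum_coe])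
    (by simp [π.tsum_coe, π'.tsum_coe]))

theorem invariant_unique {P : α → PMF α} {z : α}
    (hz : ∀ x, Relation.ReflTransGen (fun x y => P x y ≠ 0) x z) {π π' : PMF α}
    (h : π.bind P = π) (h' : π'.bind P = π') : π = π' := by
  rcases le_total (π z) (π' z) with hle | hle
  · exact eq_of_invariant_of_apply_le hz h h' hle
  · exact (eq_of_invariant_of_apply_le hz h' h hle).symm

/-- The law after `t` steps of the chain with transition law `P` that starts at `z`. -/
def lawAt (P : α → PMF α) (z : α) : ℕ → PMF α
  | 0 => PMF.pure z
  | t + 1 => (lawAt P z t).bind P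

theorem lawAt_support {P : α → PMF α} {z : α} {G : Set α} (hz : z ∈ G)
    (hG : ∀ x ∈ G, ∀ y, P x y ≠ 0 → y ∈ G) (t : ℕ) : ∀ x, lawAt P z t x ≠ 0 → x ∈ G := by
  classical
  induction t with
  | zero =>
    intro x hx
    have : x = z := by
      by_contra hne
      exact hx (by simp [lawAt, hne])
    rwa [this]
  | succ t ih =>
    intro y hy
    rw [lawAt, PMF.bind_apply] at hy
    obtain ⟨x, hx⟩ : ∃ x, lawAt P z t x * P x y ≠ 0 := by
      by_contra! h
      exact hy (ENNReal.tsum_eq_zero.2 h)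
    exact hG x (ih x (left_ne_zero_of_mul hx)) y (right_ne_zero_of_mul hx)

/-- A geometric drift inequality on a closed set bounds a moment uniformly in time. -/
theorem lmean_lawAt_le {P : α → PMF α} {z : α} {G : Set α} (hz : z ∈ G)
    (hG : ∀ x ∈ G, ∀ y, P x y ≠ 0 → y ∈ G) {V : α → ℝ≥0∞} {ρ K B : ℝ≥0∞}
    (hV : ∀ x ∈ G, lmean (P x) V ≤ ρ * V x + K) (hB : ρ * B + K ≤ B) (h0 : V z ≤ B) (t : ℕ) :
    lmean (lawAt P z t) V ≤ B := by
  induction t with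
  | zero => rwa [lawAt, lmean_pure]
  | succ t ih =>
    calc lmean (lawAt P z (t + 1)) V
        = lmean (lawAt P z t) fun x => lmean (P x) V := by rw [lawAt, lmean_bind]
      _ ≤ lmean (lawAt P z t) fun x => ρ * V x + K :=
          lmean_mono_of_support fun x hx => hV x (lawAt_support hz hG t x hx)
      _ = ρ * lmean (lawAt P z t) V + K := by rw [lmean_add, lmean_const_mul, lmean_const]
      _ ≤ ρ * B + K := by gcongr
      _ ≤ B := hB

/-- The average of the laws of the chain at the times `0, …, T`. -/
def cesaro (P : α → PMF α) (z : α) (T : ℕ) (x : α) : ℝ≥0∞ :=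
  (∑ t ∈ Finset.range (T + 1), lawAt P z t x) * ((T + 1 : ℕ) : ℝ≥0∞)⁻¹

theorem tsum_cesaro_mul (P : α → PMF α) (z : α) (T : ℕ) (f : α → ℝ≥0∞) :
    ∑' x, cesaro P z T x * f x =
      (∑ t ∈ Finset.range (T + 1), lmean (lawAt P z t) f) * ((T + 1 : ℕ) : ℝ≥0∞)⁻¹ := by
  simp only [cesaro, lmean]
  rw [← Summable.tsum_finsetSum fun _ _ => ENNReal.summable, ← ENNReal.tsum_mul_right]
  simp only [Finset.sum_mul]
  refine tsum_congr fun x => Finset.sum_congr rfl fun t _ => by ring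

theorem tsum_cesaro_mul_le {P : α → PMF α} {z : α} {f : α → ℝ≥0∞} {B : ℝ≥0∞}
    (hB : ∀ t, lmean (lawAt P z t) f ≤ B) (T : ℕ) : ∑' x, cesaro P z T x * f x ≤ B := by
  rw [tsum_cesaro_mul, ← div_eq_mul_inv]
  refine ENNReal.div_le_of_le_mul ?_
  calc ∑ t ∈ Finset.range (T + 1), lmean (lawAt P z t) f
      ≤ ∑ _t ∈ Finset.range (T + 1), B := Finset.sum_le_sum fun t _ => hB t
    _ = B * ((T + 1 : ℕ) : ℝ≥0∞) := by simp [mul_comm]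

theorem tsum_cesaro (P : α → PMF α) (z : α) (T : ℕ) : ∑' x, cesaro P z T x = 1 := by
  have h := tsum_cesaro_mul P z T fun _ => 1
  simp only [mul_one, lmean_const, Finset.sum_const, Finset.card_range, nsmul_eq_mul] at h
  rw [h]
  exact ENNReal.mul_inv_cancel (by simp) (by simp)

theorem tsum_cesaro_kernel_le (P : α → PMF α) (z : α) (T : ℕ) (y : α) :
    ∑' x, cesaro P z T x * P x y ≤ cesaro P z T y + ((T + 1 : ℕ) : ℝ≥0∞)⁻¹ := by
  have hshift : ∀ t, lmean (lawAt P z t) (fun x => P x y) = lawAt P z (t + 1) y := fun t => by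
    rw [lawAt, PMF.bind_apply, lmean]
  rw [tsum_cesaro_mul, cesaro]
  simp only [hshift]
  calc (∑ t ∈ Finset.range (T + 1), lawAt P z (t + 1) y) * ((T + 1 : ℕ) : ℝ≥0∞)⁻¹
      ≤ (∑ t ∈ Finset.range (T + 1), lawAt P z t y + 1) * ((T + 1 : ℕ) : ℝ≥0∞)⁻¹ := by
        gcongr
        calc ∑ t ∈ Finset.range (T + 1), lawAt P z (t + 1) y
            ≤ ∑ t ∈ Finset.range (T + 1), lawAt P z (t + 1) y + lawAt P z 0 y := le_self_add
          _ = ∑ t ∈ Finset.range (T + 1), lawAt P z t y + lawAt P z (T + 1) y := by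
            rw [← Finset.sum_range_succ' (fun t => lawAt P z t y), Finset.sum_range_succ]
          _ ≤ _ := by gcongr; exact PMF.coe_le_one _ _
    _ = _ := by rw [add_mul, one_mul]

/-- Fatou's lemma for sums. -/
theorem tsum_mul_le_of_tendsto {ι : Type*} {l : Filter ι} [l.NeBot] {u : ι → α → ℝ≥0∞}
    {v f : α → ℝ≥0∞} (hu : ∀ x, Tendsto (fun i => u i x) l (𝓝 (v x))) (hf : ∀ x, f x ≠ ∞)
    {w : ι → ℝ≥0∞} {B : ℝ≥0∞} (hw : Tendsto w l (𝓝 B)) (h : ∀ i, ∑' x, u i x * f x ≤ w i) :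
    ∑' x, v x * f x ≤ B := by
  rw [ENNReal.tsum_eq_iSup_sum]
  refine iSup_le fun s => ?_
  refine le_of_tendsto_of_tendsto' (tendsto_finsetSum s fun x _ =>
    ENNReal.Tendsto.mul_const (hu x) (Or.inr (hf x))) hw fun i => ?_
  exact (ENNReal.sum_le_tsum s).trans (h i)

/-- Existence of an invariant law for a chain with a coercive function `Ψ` of bounded mean, by the
Krylov–Bogoliubov argument: a limit of the time averages along an ultrafilter. The bounds on moments
that hold uniformly in time are inherited by the invariant law. -/
theorem exists_invariant {P : α → PMF α} {z : α} {Ψ : α → ℝ≥0∞} {B : ℝ≥0∞} (hB : B ≠ ∞)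
    (hfin : ∀ M : ℕ, {x | Ψ x < M}.Finite) (hΨ : ∀ t, lmean (lawAt P z t) Ψ ≤ B) :
    ∃ π : PMF α, π.bind P = π ∧ ∀ (V : α → ℝ≥0∞) (C : ℝ≥0∞), (∀ x, V x ≠ ∞) →
      (∀ t, lmean (lawAt P z t) V ≤ C) → lmean π V ≤ C := by
  classical
  set l : Filter ℕ := (hyperfilter ℕ : Filter ℕ) with hl
  have hlim : ∀ x, ∃ v, Tendsto (fun T => cesaro P z T x) l (𝓝 v) := by
    intro x
    obtain ⟨v, -, hv⟩ := isCompact_univ.ultrafilter_le_nhds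
      ((hyperfilter ℕ).map fun T => cesaro P z T x) (by simp)
    exact ⟨v, hv⟩
  choose v hv using hlim
  have hinv : Tendsto (fun T : ℕ => ((T + 1 : ℕ) : ℝ≥0∞)⁻¹) l (𝓝 0) :=
    ((tendsto_add_atTop_iff_nat 1).2 ENNReal.tendsto_inv_nat_nhds_zero).mono_left
      Nat.hyperfilter_le_atTop
  have hle : ∑' x, v x ≤ 1 := by
    simpa using tsum_mul_le_of_tendsto (f := fun _ => 1) hv (by simp) tendsto_const_nhds
      fun T => by simp [tsum_cesaro]
  -- no mass escapes: by Markov's inequality all but `B / M` of it stays in the set `{Ψ < M}`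
  have hge : 1 ≤ ∑' x, v x := by
    have hM : ∀ M : ℕ, 1 ≤ ∑' x, v x + B * ((M + 1 : ℕ) : ℝ≥0∞)⁻¹ := by
      intro M
      set s : Finset α := (hfin (M + 1)).toFinset with hs
      have hT : ∀ T, 1 ≤ ∑ x ∈ s, cesaro P z T x + B * ((M + 1 : ℕ) : ℝ≥0∞)⁻¹ := by
        intro T
        have hpt : ∀ x, cesaro P z T x ≤ (if x ∈ s then cesaro P z T x else 0)
            + (cesaro P z T x * Ψ x) * ((M + 1 : ℕ) : ℝ≥0∞)⁻¹ := by
          intro x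
          split_ifs with hx
          · exact le_self_add
          · have hx' : ((M + 1 : ℕ) : ℝ≥0∞) ≤ Ψ x := by
              by_contra hlt
              exact hx (by rw [hs, Set.Finite.mem_toFinset]; exact not_le.1 hlt)
            rw [zero_add, mul_assoc]
            calc cesaro P z T x
                = cesaro P z T x * (((M + 1 : ℕ) : ℝ≥0∞) * ((M + 1 : ℕ) : ℝ≥0∞)⁻¹) := by
                  rw [ENNReal.mul_inv_cancel (by simp) (by simp), mul_one]
              _ ≤ _ := by gcongr
        calc 1 = ∑' x, cesaro P z T x := (tsum_cesaro P z T).symm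
          _ ≤ ∑' x, ((if x ∈ s then cesaro P z T x else 0)
              + (cesaro P z T x * Ψ x) * ((M + 1 : ℕ) : ℝ≥0∞)⁻¹) := ENNReal.tsum_le_tsum hpt
          _ = ∑ x ∈ s, cesaro P z T x
              + (∑' x, cesaro P z T x * Ψ x) * ((M + 1 : ℕ) : ℝ≥0∞)⁻¹ := by
            rw [ENNReal.tsum_add, ENNReal.tsum_mul_right,
              tsum_eq_sum (s := s) fun x hx => if_neg hx]
            congr 1
            exact Finset.sum_congr rfl fun x hx => if_pos hx
          _ ≤ _ := by gcongr; exact tsum_cesaro_mul_le hΨ T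
      have h1 : 1 ≤ ∑ x ∈ s, v x + B * ((M + 1 : ℕ) : ℝ≥0∞)⁻¹ :=
        ge_of_tendsto' ((tendsto_finsetSum s fun x _ => hv x).add_const _) hT
      exact h1.trans (by gcongr; exact ENNReal.sum_le_tsum s)
    have hlimM : Tendsto (fun M : ℕ => ∑' x, v x + B * ((M + 1 : ℕ) : ℝ≥0∞)⁻¹) atTop
        (𝓝 (∑' x, v x + B * 0)) :=
      tendsto_const_nhds.add (ENNReal.Tendsto.const_mul
        ((tendsto_add_atTop_iff_nat 1).2 ENNReal.tendsto_inv_nat_nhds_zero) (Or.inr hB))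
    simpa using ge_of_tendsto' hlimM hM
  have hsum : ∑' x, v x = 1 := le_antisymm hle hge
  have hker : (fun y => ∑' x, v x * P x y) = v := by
    refine eq_of_le_of_tsum_le (fun y => ?_) (by rw [tsum_kernel, hsum]; simp)
      (by rw [tsum_kernel])
    refine tsum_mul_le_of_tendsto hv (fun x => PMF.apply_ne_top _ _) ?_
      fun T => tsum_cesaro_kernel_le P z T y
    simpa using (hv y).add hinv
  obtain ⟨π, rfl⟩ : ∃ π : PMF α, ⇑π = v := ⟨⟨v, hsum ▸ ENNReal.summable.hasSum⟩, rfl⟩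
  refine ⟨π, ?_, fun V C hV hC => ?_⟩
  · ext y
    rw [PMF.bind_apply]
    exact congrFun hker y
  · exact tsum_mul_le_of_tendsto hv hV tendsto_const_nhds fun T => tsum_cesaro_mul_le hC T

end Discrete

/-! ### Moment generating functions of bounded laws -/

section Bounded

variable {p : PMF ℕ} {M : ℕ}

theorem mean_eq_sum (hp : ∀ k, M < k → p k = 0) :
    mean p = ∑ k ∈ Finset.range (M + 1), (k : ℝ) * (p k).toReal :=
  tsum_eq_sum fun k hk => by
    rw [hp k (by simpa using hk)]
    simp

theorem sum_toReal_eq_one (hp : ∀ k, M < k → p k = 0) :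
    ∑ k ∈ Finset.range (M + 1), (p k).toReal = 1 := by
  have h : ∑ k ∈ Finset.range (M + 1), p k = 1 :=
    (tsum_eq_sum fun k hk => hp k (by simpa using hk)).symm.trans p.tsum_coe
  rw [← ENNReal.toReal_sum fun k _ => p.apply_ne_top k, h, ENNReal.toReal_one]

theorem lmean_ofReal_affine (hp : ∀ k, M < k → p k = 0) {a b : ℝ}
    (h : ∀ k : ℕ, k ≤ M → 0 ≤ a + b * k) :
    lmean p (fun k => ENNReal.ofReal (a + b * k)) = ENNReal.ofReal (a + b * mean p) := by
  have hterm : ∀ k ∈ Finset.range (M + 1), p k * ENNReal.ofReal (a + b * k)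
      = ENNReal.ofReal ((p k).toReal * (a + b * k)) := fun k _ => by
    rw [ENNReal.ofReal_mul ENNReal.toReal_nonneg, ENNReal.ofReal_toReal (p.apply_ne_top k)]
  rw [lmean, tsum_eq_sum (s := Finset.range (M + 1)) fun k hk => by
    rw [hp k (by simpa using hk), zero_mul], Finset.sum_congr rfl hterm,
    ← ENNReal.ofReal_sum_of_nonneg fun k hk =>
      mul_nonneg ENNReal.toReal_nonneg (h k (by simpa [Nat.lt_succ_iff] using hk))]
  congr 1
  calc ∑ k ∈ Finset.range (M + 1), (p k).toReal * (a + b * k)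
      = a * ∑ k ∈ Finset.range (M + 1), (p k).toReal
        + b * ∑ k ∈ Finset.range (M + 1), (k : ℝ) * (p k).toReal := by
        rw [Finset.mul_sum, Finset.mul_sum, ← Finset.sum_add_distrib]
        exact Finset.sum_congr rfl fun k _ => by ring
    _ = a + b * mean p := by rw [sum_toReal_eq_one hp, mean_eq_sum hp, mul_one]

theorem exp_le_one_add_add_sq {c : ℝ} {k : ℕ} (hk : k ≤ M) (hc : |c| * M ≤ 1) :
    Real.exp (c * k) ≤ 1 + c * k + c ^ 2 * M ^ 2 ∧ -1 ≤ c * k := by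
  have hkM : (k : ℝ) ≤ M := by exact_mod_cast hk
  have habs : |c * k| ≤ |c| * M := by
    rw [abs_mul, Nat.abs_cast]
    gcongr
  have h := (abs_le.1 (Real.abs_exp_sub_one_sub_id_le (habs.trans hc))).2
  have hsq : (c * k) ^ 2 ≤ c ^ 2 * M ^ 2 := by
    rw [mul_pow]
    gcongr
  exact ⟨by linarith, (abs_le.1 (habs.trans hc)).1⟩

/-- The moment generating function of a bounded law for a small parameter `c`, thinned by an
independent event of probability `w`. -/
theorem lmean_thinned_exp_le (hp : ∀ k, M < k → p k = 0) {c w : ℝ} (hw0 : 0 ≤ w) (hw1 : w ≤ 1)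
    (hc : |c| * M ≤ 1) :
    lmean p (fun k => ENNReal.ofReal (1 + w * (Real.exp (c * k) - 1)))
      ≤ ENNReal.ofReal (Real.exp (c * (w * mean p) + c ^ 2 * M ^ 2)) := by
  have hsq : 0 ≤ c ^ 2 * (M : ℝ) ^ 2 := by positivity
  calc lmean p (fun k => ENNReal.ofReal (1 + w * (Real.exp (c * k) - 1)))
      ≤ lmean p (fun k => ENNReal.ofReal ((1 + c ^ 2 * M ^ 2) + w * c * k)) := by
        refine lmean_mono_of_support fun k hk => ENNReal.ofReal_le_ofReal ?_
        have hkM : k ≤ M := by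
          by_contra hlt
          exact hk (hp k (not_le.1 hlt))
        have h1 := (exp_le_one_add_add_sq hkM hc).1
        nlinarith
    _ = ENNReal.ofReal ((1 + c ^ 2 * M ^ 2) + w * c * mean p) := by
        refine lmean_ofReal_affine hp fun k hkM => ?_
        have h1 := (exp_le_one_add_add_sq hkM hc).2
        nlinarith
    _ ≤ _ := by
        refine ENNReal.ofReal_le_ofReal ?_
        have h1 := Real.add_one_le_exp (c * (w * mean p) + c ^ 2 * (M : ℝ) ^ 2)
        linarith

end Bounded

variable {N : ℕ}

namespace Family

/-! ### The chance of a server to get the arrivals -/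

/-- The total service rate `μ_Σ`. -/
def totalRate (F : Family N) : ℝ := ∑ n, F.rate n

/-- The probability that the arrivals are sent to server `n` when the memory is `m`. -/
def dispatchProb (F : Family N) (m : Finset (Fin N)) (n : Fin N) : ℝ :=
  if n ∈ candidates m then F.rate n / ∑ j ∈ candidates m, F.rate j else 0

theorem rate_pos (F : Family N) (n : Fin N) : 0 < F.rate n := F.service_mean_pos n

theorem rate_le_totalRate (F : Family N) (n : Fin N) : F.rate n ≤ F.totalRate :=
  Finset.single_le_sum (fun j _ => (F.rate_pos j).le) (Finset.mem_univ n)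

theorem candidates_nonempty (F : Family N) (m : Finset (Fin N)) : (candidates m).Nonempty := by
  unfold candidates
  split_ifs with hm
  · exact hm
  · exact ⟨⟨0, F.servers_pos⟩, Finset.mem_univ _⟩

theorem sum_candidates_pos (F : Family N) (m : Finset (Fin N)) :
    0 < ∑ j ∈ candidates m, F.rate j :=
  Finset.sum_pos (fun j _ => F.rate_pos j) (F.candidates_nonempty m)

theorem dispatchProb_nonneg (F : Family N) (m : Finset (Fin N)) (n : Fin N) :
    0 ≤ F.dispatchProb m n := by
  unfold dispatchProb
  split_ifs
  · exact div_nonneg (F.rate_pos n).le (F.sum_candidates_pos m).le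
  · exact le_rfl

theorem sum_dispatchProb (F : Family N) (m : Finset (Fin N)) : ∑ n, F.dispatchProb m n = 1 := by
  simp only [dispatchProb, Finset.sum_ite_mem, Finset.univ_inter]
  rw [← Finset.sum_div, div_self (F.sum_candidates_pos m).ne']

theorem dispatchProb_le_one (F : Family N) (m : Finset (Fin N)) (n : Fin N) :
    F.dispatchProb m n ≤ 1 := by
  rw [← F.sum_dispatchProb m]
  exact Finset.single_le_sum (fun j _ => F.dispatchProb_nonneg m j) (Finset.mem_univ n)

theorem dispatch_apply (F : Family N) (m : Finset (Fin N)) (n : Fin N) :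
    F.dispatch m n = ENNReal.ofReal (F.dispatchProb m n) := by
  have hsum : ∑' i, F.weight m i = ENNReal.ofReal (∑ j ∈ candidates m, F.rate j) := by
    simp only [tsum_fintype, weight, Finset.sum_ite_mem, Finset.univ_inter]
    rw [ENNReal.ofReal_sum_of_nonneg fun j _ => (F.rate_pos j).le]
  rw [dispatch, PMF.normalize_apply, hsum, weight, dispatchProb]
  split_ifs
  · rw [ENNReal.ofReal_div_of_pos (F.sum_candidates_pos m), div_eq_mul_inv]
  · simp

theorem dispatchProb_of_mem (F : Family N) {m : Finset (Fin N)} {n : Fin N} (hn : n ∈ m) :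
    F.dispatchProb m n = F.rate n / ∑ j ∈ m, F.rate j := by
  have hc : candidates m = m := if_pos ⟨n, hn⟩
  rw [dispatchProb, hc, if_pos hn]

theorem dispatchProb_of_notMem (F : Family N) {m : Finset (Fin N)} {n : Fin N}
    (hm : m.Nonempty) (hn : n ∉ m) : F.dispatchProb m n = 0 := by
  have hc : candidates m = m := if_pos hm
  rw [dispatchProb, hc, if_neg hn]

theorem dispatchProb_empty (F : Family N) (n : Fin N) :
    F.dispatchProb ∅ n = F.rate n / F.totalRate := by
  simp [dispatchProb, candidates, totalRate]

/-! ### One step of a single queue -/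

theorem lmean_jointService (F : Family N) (n : Fin N) (f : ℕ → ℝ≥0∞) :
    lmean F.jointService (fun s => f (s n)) = lmean (F.service n) f := by
  have h1 : lmean F.jointService (fun s => f (s n))
      = ∫⁻ s, f (s n) ∂(MeasureTheory.Measure.pi fun n => (F.service n).toMeasure) := by
    rw [← MeasureTheory.Measure.toPMF_toMeasure
      (MeasureTheory.Measure.pi fun n => (F.service n).toMeasure), MeasureTheory.lintegral_countable']
    refine tsum_congr fun s => ?_
    rw [PMF.toMeasure_apply_singleton _ _ (MeasurableSet.singleton _), mul_comm]
    rfl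
  have h2 : lmean (F.service n) f = ∫⁻ k, f k ∂(F.service n).toMeasure := by
    rw [MeasureTheory.lintegral_countable']
    refine tsum_congr fun s => ?_
    rw [PMF.toMeasure_apply_singleton _ _ (MeasurableSet.singleton _), mul_comm]
  rw [h1, h2]
  exact (MeasureTheory.measurePreserving_eval (fun n => (F.service n).toMeasure) n).lintegral_comp
    (measurable_of_countable f)

theorem lmean_step (F : Family N) (ε r : ℝ) (z : State N) (f : State N → ℝ≥0∞) :
    lmean (F.step ε r z) f = lmean (F.arrival ε) fun a => lmean F.jointService fun s =>
      lmean (F.dispatch z.2) fun i =>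
        f (nextQueue z.1 a s i, nextMemory r z.2 a i (nextQueue z.1 a s i)) := by
  simp only [step, lmean_bind, lmean_pure]

theorem lmean_dispatch_exp (F : Family N) (m : Finset (Fin N)) (n : Fin N) (c : ℝ) (a : ℕ) :
    lmean (F.dispatch m) (fun i => ENNReal.ofReal (Real.exp (c * ((if n = i then a else 0 : ℕ) : ℝ))))
      = ENNReal.ofReal (1 + F.dispatchProb m n * (Real.exp (c * a) - 1)) := by
  simp only [lmean, tsum_fintype, F.dispatch_apply]
  have hterm : ∀ i, ENNReal.ofReal (F.dispatchProb m i)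
      * ENNReal.ofReal (Real.exp (c * ((if n = i then a else 0 : ℕ) : ℝ)))
      = ENNReal.ofReal (F.dispatchProb m i * Real.exp (c * ((if n = i then a else 0 : ℕ) : ℝ))) :=
    fun i => (ENNReal.ofReal_mul (F.dispatchProb_nonneg m i)).symm
  simp only [hterm]
  rw [← ENNReal.ofReal_sum_of_nonneg fun i _ =>
    mul_nonneg (F.dispatchProb_nonneg m i) (Real.exp_pos _).le]
  congr 1
  have hite : ∀ i, F.dispatchProb m i * Real.exp (c * ((if n = i then a else 0 : ℕ) : ℝ))
      = F.dispatchProb m i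
        + if n = i then F.dispatchProb m i * (Real.exp (c * a) - 1) else 0 := by
    intro i
    split_ifs
    · ring
    · simp
  simp only [hite, Finset.sum_add_distrib, F.sum_dispatchProb, Finset.sum_ite_eq,
    Finset.mem_univ, if_true]

/-- An exponential moment of one queue after a step: up to the boundary term `1`, it is multiplied
by the moment generating function of the net input `A_n - S_n`. -/
theorem lmean_step_le (F : Family N) {ε : ℝ} (hε : 0 < ε) (hεμ : ε < F.totalRate) (r : ℝ)
    (z : State N) (n : Fin N) {c x : ℝ} (hcA : |c| * F.Amax ≤ 1) (hcS : |c| * F.Smax ≤ 1)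
    {g : ℕ → ℝ≥0∞}
    (hg : ∀ a s : ℕ, g (z.1 n + a - s) ≤ ENNReal.ofReal (Real.exp (x + c * a - c * s)) + 1) :
    lmean (F.step ε r z) (fun z' => g (z'.1 n)) ≤
      ENNReal.ofReal (Real.exp (x + (c * (F.dispatchProb z.2 n * (F.totalRate - ε) - F.rate n)
        + c ^ 2 * ((F.Amax : ℝ) ^ 2 + (F.Smax : ℝ) ^ 2)))) + 1 := by
  have hmean : mean (F.arrival ε) = F.totalRate - ε := F.arrival_mean ε hε hεμ
  have hS : lmean (F.service n) (fun k => ENNReal.ofReal (Real.exp (-c * k)))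
      ≤ ENNReal.ofReal (Real.exp (-c * F.rate n + c ^ 2 * (F.Smax : ℝ) ^ 2)) := by
    have h := lmean_thinned_exp_le (c := -c) (F.service_le n) zero_le_one le_rfl
      (by rwa [abs_neg])
    simpa [rate] using h
  have hA := lmean_thinned_exp_le (c := c) (F.arrival_le ε hε hεμ) (F.dispatchProb_nonneg z.2 n)
    (F.dispatchProb_le_one z.2 n) hcA
  rw [hmean] at hA
  rw [lmean_step]
  calc (lmean (F.arrival ε) fun a => lmean F.jointService fun s => lmean (F.dispatch z.2) fun i =>
        g (z.1 n + (if n = i then a else 0) - s n))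
      ≤ lmean (F.arrival ε) fun a => lmean F.jointService fun s => lmean (F.dispatch z.2) fun i =>
          ENNReal.ofReal (Real.exp x) * (ENNReal.ofReal (Real.exp (-c * s n)) *
            ENNReal.ofReal (Real.exp (c * ((if n = i then a else 0 : ℕ) : ℝ)))) + 1 := by
        refine lmean_mono fun a => lmean_mono fun s => lmean_mono fun i => ?_
        refine (hg _ _).trans_eq ?_
        rw [← ENNReal.ofReal_mul (Real.exp_pos _).le, ← ENNReal.ofReal_mul (Real.exp_pos _).le,
          ← Real.exp_add, ← Real.exp_add]
        congr 3
        ring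
    _ = ENNReal.ofReal (Real.exp x) *
          (lmean (F.service n) (fun k => ENNReal.ofReal (Real.exp (-c * k))) *
            lmean (F.arrival ε) fun a =>
              ENNReal.ofReal (1 + F.dispatchProb z.2 n * (Real.exp (c * a) - 1))) + 1 := by
        simp only [lmean_add, lmean_const, lmean_const_mul, lmean_mul_const, lmean_dispatch_exp]
        rw [← F.lmean_jointService n fun k => ENNReal.ofReal (Real.exp (-c * k))]
    _ ≤ ENNReal.ofReal (Real.exp x) *
          (ENNReal.ofReal (Real.exp (-c * F.rate n + c ^ 2 * (F.Smax : ℝ) ^ 2)) *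
            ENNReal.ofReal (Real.exp (c * (F.dispatchProb z.2 n * (F.totalRate - ε))
              + c ^ 2 * (F.Amax : ℝ) ^ 2))) + 1 := by gcongr
    _ = _ := by
        rw [← ENNReal.ofReal_mul (Real.exp_pos _).le, ← ENNReal.ofReal_mul (Real.exp_pos _).le,
          ← Real.exp_add, ← Real.exp_add]
        congr 3
        ring

/-- A bound on the second order terms of the net input of a server; the summand `1` makes it also
an upper bound of `Amax`, of `Smax` and of `1`. -/
def inputBound (F : Family N) : ℝ := (F.Amax : ℝ) ^ 2 + (F.Smax : ℝ) ^ 2 + 1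

/-- The additive constant in the drift inequality of a single queue. -/
def driftConst (F : Family N) : ℝ := Real.exp (F.totalRate + 1) + 1

theorem inputBound_pos (F : Family N) : 0 < F.inputBound := by
  unfold inputBound
  positivity

/-- The exponential drift inequality of a single queue. Where the exponent `x` is positive, the net
input has to push it down at a rate `δ`; where it is not, the moment is just bounded. -/
theorem lmean_step_contract (F : Family N) {ε : ℝ} (hε : 0 < ε) (hεμ : ε < F.totalRate) (r : ℝ)
    (z : State N) (n : Fin N) {c x δ : ℝ} (hc1 : |c| * F.inputBound ≤ 1)
    (hcδ : |c| * F.inputBound ≤ δ / 2) {g : ℕ → ℝ≥0∞}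
    (hg : ∀ a s : ℕ, g (z.1 n + a - s) ≤ ENNReal.ofReal (Real.exp (x + c * a - c * s)) + 1)
    (h : x ≤ 0 ∨ c * (F.dispatchProb z.2 n * (F.totalRate - ε) - F.rate n) ≤ -(|c| * δ)) :
    lmean (F.step ε r z) (fun z' => g (z'.1 n)) ≤
      ENNReal.ofReal (Real.exp (-(|c| * δ / 2))) * ENNReal.ofReal (Real.exp (max x 0))
        + ENNReal.ofReal F.driftConst := by
  have hc0 : 0 ≤ |c| := abs_nonneg c
  have hA0 : (0 : ℝ) ≤ F.Amax := Nat.cast_nonneg _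
  have hS0 : (0 : ℝ) ≤ F.Smax := Nat.cast_nonneg _
  have hcA : |c| * F.Amax ≤ 1 := by
    refine le_trans (mul_le_mul_of_nonneg_left ?_ hc0) hc1
    unfold inputBound
    nlinarith [sq_nonneg ((F.Amax : ℝ) - 1)]
  have hcS : |c| * F.Smax ≤ 1 := by
    refine le_trans (mul_le_mul_of_nonneg_left ?_ hc0) hc1
    unfold inputBound
    nlinarith [sq_nonneg ((F.Smax : ℝ) - 1)]
  have hcle : |c| ≤ 1 := by
    refine le_trans (le_mul_of_one_le_right hc0 ?_) hc1
    unfold inputBound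
    nlinarith [sq_nonneg (F.Amax : ℝ), sq_nonneg (F.Smax : ℝ)]
  have hsq : c ^ 2 * ((F.Amax : ℝ) ^ 2 + (F.Smax : ℝ) ^ 2) ≤ |c| * (|c| * F.inputBound) := by
    rw [← sq_abs c, inputBound]
    nlinarith [sq_nonneg |c|]
  refine (F.lmean_step_le hε hεμ r z n hcA hcS hg).trans ?_
  have hK : ENNReal.ofReal F.driftConst = ENNReal.ofReal (Real.exp (F.totalRate + 1)) + 1 := by
    rw [driftConst, ENNReal.ofReal_add (Real.exp_pos _).le zero_le_one, ENNReal.ofReal_one]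
  rw [hK, ← add_assoc (_ * _ : ℝ≥0∞)]
  refine add_le_add ?_ le_rfl
  rcases h with hx | hd
  · refine le_trans (ENNReal.ofReal_le_ofReal (Real.exp_le_exp.2 ?_)) le_add_self
    have hw0 := F.dispatchProb_nonneg z.2 n
    have hw1 := F.dispatchProb_le_one z.2 n
    have habs : |F.dispatchProb z.2 n * (F.totalRate - ε) - F.rate n| ≤ F.totalRate := by
      have h1 := F.rate_pos n
      have h2 := F.rate_le_totalRate n
      have h3 : F.dispatchProb z.2 n * (F.totalRate - ε) ≤ F.totalRate - ε :=
        mul_le_of_le_one_left (by linarith) hw1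
      have h4 : 0 ≤ F.dispatchProb z.2 n * (F.totalRate - ε) := mul_nonneg hw0 (by linarith)
      exact abs_le.2 ⟨by linarith, by linarith⟩
    have h5 : c * (F.dispatchProb z.2 n * (F.totalRate - ε) - F.rate n) ≤ F.totalRate := by
      refine (le_abs_self _).trans ?_
      rw [abs_mul]
      exact (mul_le_of_le_one_left (abs_nonneg _) hcle).trans habs
    have h6 : |c| * (|c| * F.inputBound) ≤ 1 := by nlinarith
    linarith
  · refine le_trans ?_ le_self_add
    rw [← ENNReal.ofReal_mul (Real.exp_pos _).le, ← Real.exp_add]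
    refine ENNReal.ofReal_le_ofReal (Real.exp_le_exp.2 ?_)
    have h1 : |c| * (|c| * F.inputBound) ≤ |c| * (δ / 2) := mul_le_mul_of_nonneg_left hcδ hc0
    have h2 := le_max_left x 0
    linarith

end Family

/-! ### The memory lists the servers below the threshold -/

/-- The states in which the memory holds exactly the IDs of the servers below the threshold. -/
def consistent (N : ℕ) (r : ℝ) : Set (State N) :=
  {z | z.2 = Finset.univ.filter fun n => (z.1 n : ℝ) < r}

theorem mem_memory_iff {r : ℝ} {z : State N} (hz : z ∈ consistent N r) (n : Fin N) :
    n ∈ z.2 ↔ (z.1 n : ℝ) < r := by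
  rw [show z.2 = _ from hz]
  simp

/-- The state with empty queues and all IDs in memory. -/
def emptyState (N : ℕ) : State N := (fun _ => 0, Finset.univ)

theorem emptyState_mem {r : ℝ} (hr : 0 < r) : emptyState N ∈ consistent N r := by
  simp [emptyState, consistent, hr]

namespace Family

theorem step_ne_zero_iff (F : Family N) (ε r : ℝ) (z z' : State N) :
    F.step ε r z z' ≠ 0 ↔ ∃ a, F.arrival ε a ≠ 0 ∧ ∃ s, F.jointService s ≠ 0 ∧
      ∃ i, F.dispatch z.2 i ≠ 0 ∧
        z' = (nextQueue z.1 a s i, nextMemory r z.2 a i (nextQueue z.1 a s i)) := by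
  rw [← PMF.mem_support_iff]
  simp only [step, PMF.mem_support_bind_iff, PMF.mem_support_pure_iff]
  simp only [PMF.mem_support_iff]

theorem consistent_closed (F : Family N) (ε r : ℝ) :
    ∀ z ∈ consistent N r, ∀ z', F.step ε r z z' ≠ 0 → z' ∈ consistent N r := by
  intro z hz z' hz'
  obtain ⟨a, -, s, -, i, -, rfl⟩ := (F.step_ne_zero_iff ε r z z').1 hz'
  refine Finset.union_eq_right.2 fun n hn => ?_
  -- an ID that stays in memory belongs to a server without arrivals, whose queue did not grow
  have hmem : n ∈ z.2 ∧ (if n = i then a else 0) = 0 := by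
    split_ifs at hn with ha
    · exact ⟨hn, by simp [ha]⟩
    · rw [Finset.mem_erase] at hn
      exact ⟨hn.2, if_neg hn.1⟩
  rw [Finset.mem_filter]
  refine ⟨Finset.mem_univ n, lt_of_le_of_lt ?_ ((mem_memory_iff hz n).1 hmem.1)⟩
  rw [nextQueue, hmem.2]
  exact_mod_cast Nat.sub_le _ _

/-! ### All states lead to the empty one -/

theorem exists_service_ne_zero (F : Family N) (n : Fin N) : ∃ k, k ≠ 0 ∧ F.service n k ≠ 0 := by
  by_contra! h
  refine (F.service_mean_pos n).ne' ?_
  rw [mean]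
  convert tsum_zero with k
  rcases eq_or_ne k 0 with rfl | hk
  · simp
  · simp [h k hk]

theorem exists_jointService_ne_zero (F : Family N) :
    ∃ s : Fin N → ℕ, (∀ n, s n ≠ 0) ∧ F.jointService s ≠ 0 := by
  choose s hs using F.exists_service_ne_zero
  refine ⟨s, fun n => (hs n).1, ?_⟩
  change (MeasureTheory.Measure.pi fun n => (F.service n).toMeasure) {s} ≠ 0
  rw [MeasureTheory.Measure.pi_singleton]
  refine Finset.prod_ne_zero_iff.2 fun n _ => ?_
  rw [PMF.toMeasure_apply_singleton _ _ (MeasurableSet.singleton _)]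
  exact (hs n).2

theorem reaches_emptyState (F : Family N) {ε r : ℝ} (hε : 0 < ε) (hεμ : ε < F.totalRate)
    (hr : 0 < r) (z : State N) :
    Relation.ReflTransGen (fun x y => F.step ε r x y ≠ 0) z (emptyState N) := by
  obtain ⟨s, hs, hs0⟩ := F.exists_jointService_ne_zero
  -- with no arrivals and service at every server, all nonempty queues get shorter
  have hstep : ∀ z : State N, ∃ z', F.step ε r z z' ≠ 0 ∧ (∀ n, z'.1 n = z.1 n - s n) ∧
      ∀ n, (z'.1 n : ℝ) < r → n ∈ z'.2 := by
    intro z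
    obtain ⟨i, hi⟩ := (F.dispatch z.2).support_nonempty
    refine ⟨_, (F.step_ne_zero_iff ε r z _).2
      ⟨0, F.arrival_zero ε hε hεμ, s, hs0, i, (PMF.mem_support_iff _ _).1 hi, rfl⟩, ?_, ?_⟩
    · intro n
      simp [nextQueue]
    · intro n hn
      exact Finset.mem_union_right _ (Finset.mem_filter.2 ⟨Finset.mem_univ n, hn⟩)
  induction hk : ∑ n, z.1 n using Nat.strong_induction_on generalizing z with
  | _ k ih =>
    obtain ⟨z', hz', hq, hm⟩ := hstep z
    refine Relation.ReflTransGen.head hz' ?_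
    by_cases h0 : ∀ n, z.1 n = 0
    · have hz'0 : ∀ n, z'.1 n = 0 := fun n => by rw [hq, h0, Nat.zero_sub]
      have : z' = emptyState N := by
        refine Prod.ext (funext hz'0) (Finset.eq_univ_of_forall fun n => hm n ?_)
        rw [hz'0]
        simpa using hr
      rw [this]
    · push Not at h0
      obtain ⟨n, hn⟩ := h0
      refine ih _ ?_ z' rfl
      rw [← hk]
      refine Finset.sum_lt_sum (fun j _ => (hq j).trans_le (Nat.sub_le _ _))
        ⟨n, Finset.mem_univ n, ?_⟩
      rw [hq]
      exact Nat.sub_lt (Nat.pos_of_ne_zero hn) (Nat.pos_of_ne_zero (hs n))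

end Family

/-! ### Drift of the two exponential potentials -/

/-- The exponential potential of the excess of the queues over the threshold. It lies between
`exp (θ ‖(q - r)⁺‖_∞)` and `N` times that number. -/
def lowerPot (r θ : ℝ) (q : Fin N → ℕ) : ℝ≥0∞ :=
  ∑ n, ENNReal.ofReal (Real.exp (max (θ * (q n - r)) 0))

/-- The exponential potential of the shortfall of the queues below the threshold. It lies between
`exp (θ ‖(r - q)⁺‖_∞)` and `N` times that number. -/
def upperPot (r θ : ℝ) (q : Fin N → ℕ) : ℝ≥0∞ :=
  ∑ n, ENNReal.ofReal (Real.exp (max (θ * (r - q n)) 0))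

theorem lowerPot_ne_top (r θ : ℝ) (q : Fin N → ℕ) : lowerPot r θ q ≠ ∞ :=
  ENNReal.sum_ne_top.2 fun _ _ => ENNReal.ofReal_ne_top

theorem lowerPot_emptyState {r θ : ℝ} (hr : 0 < r) (hθ : 0 < θ) :
    lowerPot r θ (emptyState N).1 = ENNReal.ofReal N := by
  have h : max (-(θ * r)) 0 = 0 := max_eq_right (by nlinarith)
  simp [lowerPot, emptyState, h]

theorem ofReal_exp_max_le (y : ℝ) :
    ENNReal.ofReal (Real.exp (max y 0)) ≤ ENNReal.ofReal (Real.exp y) + 1 := by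
  rcases le_total y 0 with hy | hy
  · rw [max_eq_right hy]
    simp
  · rw [max_eq_left hy]
    exact le_self_add

theorem cast_le_tsub_add (a b : ℕ) : (a : ℝ) - b ≤ ((a - b : ℕ) : ℝ) := by
  have h : a ≤ (a - b) + b := le_tsub_add
  have h' : (a : ℝ) ≤ ((a - b : ℕ) : ℝ) + b := by exact_mod_cast h
  linarith

namespace Family

/-- The sum of the drift inequalities of the single queues. -/
theorem lmean_step_sum_le (F : Family N) {ε r ρ : ℝ} {z : State N} {g : ℕ → ℝ≥0∞}
    (h : ∀ n, lmean (F.step ε r z) (fun z' => g (z'.1 n))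
      ≤ ENNReal.ofReal ρ * g (z.1 n) + ENNReal.ofReal F.driftConst) :
    lmean (F.step ε r z) (fun z' => ∑ n, g (z'.1 n))
      ≤ ENNReal.ofReal ρ * ∑ n, g (z.1 n) + ENNReal.ofReal (N * F.driftConst) := by
  rw [lmean_sum]
  refine (Finset.sum_le_sum fun n _ => h n).trans_eq ?_
  rw [Finset.sum_add_distrib, Finset.mul_sum, Finset.sum_const, Finset.card_univ, Fintype.card_fin,
    nsmul_eq_mul, ENNReal.ofReal_mul (Nat.cast_nonneg N), ENNReal.ofReal_natCast]

theorem lmean_step_lowerPot_le (F : Family N) {ε r θ δ : ℝ} (hε : 0 < ε) (hεμ : ε < F.totalRate)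
    (hr : 0 < r) (hθ : 0 < θ) (h1 : θ * F.inputBound ≤ 1) (h2 : θ * F.inputBound ≤ δ / 2)
    {z : State N}
    (h : ∀ n, r ≤ z.1 n → F.dispatchProb z.2 n * (F.totalRate - ε) - F.rate n ≤ -δ) :
    lmean (F.step ε r z) (fun z' => lowerPot r θ z'.1)
      ≤ ENNReal.ofReal (Real.exp (-(θ * δ / 2))) * lowerPot r θ z.1
        + ENNReal.ofReal (N * F.driftConst) := by
  refine F.lmean_step_sum_le (g := fun k => ENNReal.ofReal (Real.exp (max (θ * (k - r)) 0)))
    fun n => ?_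
  have habs : |θ| = θ := abs_of_pos hθ
  have key := F.lmean_step_contract hε hεμ r z n (c := θ) (x := θ * (z.1 n - r)) (δ := δ)
    (g := fun k => ENNReal.ofReal (Real.exp (max (θ * (k - r)) 0)))
    (by rwa [habs]) (by rwa [habs]) ?_ ?_
  · rwa [habs] at key
  · intro a s
    rcases le_total s (z.1 n + a) with hs | hs
    · refine (ofReal_exp_max_le _).trans_eq ?_
      rw [Nat.cast_sub hs, Nat.cast_add]
      congr 3
      ring
    · -- an emptied queue is below the threshold
      rw [Nat.sub_eq_zero_of_le hs, max_eq_right (by push_cast; nlinarith)]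
      simp
  · rw [habs]
    rcases lt_or_ge (z.1 n : ℝ) r with hn | hn
    · exact Or.inl (by nlinarith)
    · exact Or.inr (by nlinarith [h n hn])

theorem lmean_step_upperPot_le (F : Family N) {ε r θ δ : ℝ} (hε : 0 < ε) (hεμ : ε < F.totalRate)
    (hθ : 0 < θ) (h1 : θ * F.inputBound ≤ 1) (h2 : θ * F.inputBound ≤ δ / 2)
    {z : State N}
    (h : ∀ n, (z.1 n : ℝ) < r → δ ≤ F.dispatchProb z.2 n * (F.totalRate - ε) - F.rate n) :
    lmean (F.step ε r z) (fun z' => upperPot r θ z'.1)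
      ≤ ENNReal.ofReal (Real.exp (-(θ * δ / 2))) * upperPot r θ z.1
        + ENNReal.ofReal (N * F.driftConst) := by
  refine F.lmean_step_sum_le (g := fun k => ENNReal.ofReal (Real.exp (max (θ * (r - k)) 0)))
    fun n => ?_
  have habs : |-θ| = θ := by rw [abs_neg, abs_of_pos hθ]
  have key := F.lmean_step_contract hε hεμ r z n (c := -θ) (x := θ * (r - z.1 n)) (δ := δ)
    (g := fun k => ENNReal.ofReal (Real.exp (max (θ * (r - k)) 0)))
    (by rwa [habs]) (by rwa [habs]) ?_ ?_
  · rwa [habs] at key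
  · intro a s
    refine (ofReal_exp_max_le _).trans ?_
    gcongr
    have h := cast_le_tsub_add (z.1 n + a) s
    push_cast at h
    nlinarith
  · rw [habs]
    rcases lt_or_ge (z.1 n : ℝ) r with hn | hn
    · exact Or.inr (by nlinarith [h n hn])
    · exact Or.inl (by nlinarith)

/-- A server above the threshold gets no arrivals while some server is below it. -/
theorem netInput_above (F : Family N) {r : ℝ} {z : State N} (hz : z ∈ consistent N r) (ε : ℝ)
    {n j : Fin N} (hn : r ≤ z.1 n) (hj : (z.1 j : ℝ) < r) :
    F.dispatchProb z.2 n * (F.totalRate - ε) - F.rate n = -F.rate n := by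
  rw [F.dispatchProb_of_notMem ⟨j, (mem_memory_iff hz j).2 hj⟩
    fun hmem => not_lt.2 hn ((mem_memory_iff hz n).1 hmem)]
  ring

/-- When all servers are above the threshold the slack `ε` is shared in proportion to the rates. -/
theorem netInput_of_forall_above (F : Family N) {r : ℝ} {z : State N} (hz : z ∈ consistent N r)
    (ε : ℝ) (h : ∀ j, r ≤ z.1 j) (n : Fin N) :
    F.dispatchProb z.2 n * (F.totalRate - ε) - F.rate n = -(ε * (F.rate n / F.totalRate)) := by
  have hm : z.2 = ∅ := Finset.eq_empty_of_forall_notMem fun j hj =>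
    not_lt.2 (h j) ((mem_memory_iff hz j).1 hj)
  have hpos : F.totalRate ≠ 0 := ((F.rate_pos n).trans_le (F.rate_le_totalRate n)).ne'
  rw [hm, F.dispatchProb_empty]
  field_simp
  ring

/-- While some server is above the threshold, those below share the whole load, which exceeds
their total service rate. -/
theorem le_netInput_below (F : Family N) {r : ℝ} {z : State N} (hz : z ∈ consistent N r)
    {ε b : ℝ} (hb : 0 < b) (hbr : ∀ n, b ≤ F.rate n) (hε : ε ≤ b / 2) {n j : Fin N}
    (hn : (z.1 n : ℝ) < r) (hj : r ≤ z.1 j) :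
    b ^ 2 / (2 * F.totalRate) ≤ F.dispatchProb z.2 n * (F.totalRate - ε) - F.rate n := by
  have hnm : n ∈ z.2 := (mem_memory_iff hz n).2 hn
  have hjm : j ∉ z.2 := fun hmem => not_lt.2 hj ((mem_memory_iff hz j).1 hmem)
  have hR : 0 < ∑ k ∈ z.2, F.rate k := Finset.sum_pos (fun k _ => F.rate_pos k) ⟨n, hnm⟩
  have hle : F.rate j + ∑ k ∈ z.2, F.rate k ≤ F.totalRate := by
    rw [← Finset.sum_insert hjm]
    exact Finset.sum_le_sum_of_subset_of_nonneg (Finset.subset_univ _)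
      fun k _ _ => (F.rate_pos k).le
  rw [F.dispatchProb_of_mem hnm]
  set R := ∑ k ∈ z.2, F.rate k
  have hj' := hbr j
  have hn' := hbr n
  have heq : F.rate n / R * (F.totalRate - ε) - F.rate n
      = F.rate n * (F.totalRate - ε - R) / R := by field_simp
  rw [heq]
  calc b ^ 2 / (2 * F.totalRate) = b * (b / 2) / F.totalRate := by ring
    _ ≤ F.rate n * (F.totalRate - ε - R) / R := by
      gcongr
      · exact mul_nonneg (F.rate_pos n).le (by linarith)
      · linarith
      · linarith
      · linarith

/-- The drift that makes the law of the queues tight: it depends on `ε`. -/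
theorem drift_lowerPot (F : Family N) {ε r b η : ℝ} (hε : 0 < ε) (hεμ : ε < F.totalRate)
    (hr : 0 < r) (hb : 0 < b) (hbr : ∀ n, b ≤ F.rate n) (hη : 0 < η)
    (h1 : η * F.inputBound ≤ 1) (h2 : η * F.inputBound ≤ ε * (b / F.totalRate) / 2)
    {z : State N} (hz : z ∈ consistent N r) :
    lmean (F.step ε r z) (fun z' => lowerPot r η z'.1)
      ≤ ENNReal.ofReal (Real.exp (-(η * (ε * (b / F.totalRate)) / 2))) * lowerPot r η z.1
        + ENNReal.ofReal (N * F.driftConst) := by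
  refine F.lmean_step_lowerPot_le hε hεμ hr hη h1 h2 fun n hn => ?_
  have hT : 0 < F.totalRate := hε.trans hεμ
  by_cases hall : ∀ j, r ≤ z.1 j
  · rw [F.netInput_of_forall_above hz ε hall]
    gcongr
    exact hbr n
  · push Not at hall
    obtain ⟨j, hj⟩ := hall
    rw [F.netInput_above hz ε hn hj, neg_le_neg_iff]
    have : ε * (b / F.totalRate) ≤ b := by
      rw [← mul_div_assoc, div_le_iff₀ hT, mul_comm]
      exact mul_le_mul_of_nonneg_left hεμ.le hb.le
    exact this.trans (hbr n)

/-- The drift towards the region, uniform in `ε`. Off the region both potentials contract; in the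
region only one of them need do so, and it is the smaller one. -/
theorem drift_min (F : Family N) {ε r b θ : ℝ} (hε : 0 < ε) (hεb : ε ≤ b / 2)
    (hr : 0 < r) (hb : 0 < b) (hbr : ∀ n, b ≤ F.rate n) (hθ : 0 < θ)
    (h1 : θ * F.inputBound ≤ 1) (h2 : θ * F.inputBound ≤ b ^ 2 / (2 * F.totalRate) / 2)
    {z : State N} (hz : z ∈ consistent N r) :
    lmean (F.step ε r z) (fun z' => min (lowerPot r θ z'.1) (upperPot r θ z'.1))
      ≤ ENNReal.ofReal (Real.exp (-(θ * (b ^ 2 / (2 * F.totalRate)) / 2)))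
          * min (lowerPot r θ z.1) (upperPot r θ z.1)
        + ENNReal.ofReal (N * F.driftConst) := by
  have hbT : b ≤ F.totalRate := (hbr ⟨0, F.servers_pos⟩).trans (F.rate_le_totalRate _)
  have hT : 0 < F.totalRate := hb.trans_le hbT
  have hεμ : ε < F.totalRate := by linarith
  have hlower : (∃ j, (z.1 j : ℝ) < r) →
      lmean (F.step ε r z) (fun z' => min (lowerPot r θ z'.1) (upperPot r θ z'.1))
      ≤ ENNReal.ofReal (Real.exp (-(θ * (b ^ 2 / (2 * F.totalRate)) / 2))) * lowerPot r θ z.1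
        + ENNReal.ofReal (N * F.driftConst) := by
    rintro ⟨j, hj⟩
    refine (lmean_mono fun _ => min_le_left _ _).trans
      (F.lmean_step_lowerPot_le hε hεμ hr hθ h1 h2 fun n hn => ?_)
    rw [F.netInput_above hz ε hn hj, neg_le_neg_iff]
    have : b ^ 2 / (2 * F.totalRate) ≤ b := by
      rw [div_le_iff₀ (by positivity)]
      nlinarith
    exact this.trans (hbr n)
  have hupper : (∃ j, r ≤ (z.1 j : ℝ)) →
      lmean (F.step ε r z) (fun z' => min (lowerPot r θ z'.1) (upperPot r θ z'.1))
      ≤ ENNReal.ofReal (Real.exp (-(θ * (b ^ 2 / (2 * F.totalRate)) / 2))) * upperPot r θ z.1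
        + ENNReal.ofReal (N * F.driftConst) := by
    rintro ⟨j, hj⟩
    exact (lmean_mono fun _ => min_le_right _ _).trans
      (F.lmean_step_upperPot_le hε hεμ hθ h1 h2 fun n hn =>
        F.le_netInput_below hz hb hbr hεb hn hj)
  by_cases hB : ∃ j, (z.1 j : ℝ) < r
  · by_cases hA : ∃ j, r ≤ (z.1 j : ℝ)
    · rcases min_choice (lowerPot r θ z.1) (upperPot r θ z.1) with h | h <;> rw [h]
      · exact hlower hB
      · exact hupper hA
    · push Not at hA
      rw [min_eq_left]
      · exact hlower hB
      · refine Finset.sum_le_sum fun n _ => ENNReal.ofReal_le_ofReal (Real.exp_le_exp.2 ?_)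
        rw [max_eq_right (by nlinarith [hA n])]
        exact le_max_right _ _
  · push Not at hB
    rw [min_eq_right]
    · exact hupper ⟨⟨0, F.servers_pos⟩, hB _⟩
    · refine Finset.sum_le_sum fun n _ => ENNReal.ofReal_le_ofReal (Real.exp_le_exp.2 ?_)
      rw [max_eq_right (by nlinarith [hB n])]
      exact le_max_right _ _

end Family

/-! ### The distance to the region -/

theorem infDist_le_of_forall_abs_le {S : Set (EuclideanSpace ℝ (Fin N))}
    {x y : EuclideanSpace ℝ (Fin N)} (hy : y ∈ S) {M : ℝ} (hN : 0 < N)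
    (hM : ∀ n, |x n - y n| ≤ M) : Metric.infDist x S ≤ N * M := by
  have hM0 : 0 ≤ M := (abs_nonneg _).trans (hM ⟨0, hN⟩)
  have hN1 : (1 : ℝ) ≤ N := by exact_mod_cast hN
  refine (Metric.infDist_le_dist_of_mem hy).trans ?_
  rw [EuclideanSpace.dist_eq]
  refine Real.sqrt_le_iff.2 ⟨by positivity, ?_⟩
  calc ∑ n, dist (x n) (y n) ^ 2 ≤ ∑ _n : Fin N, M ^ 2 := by
        refine Finset.sum_le_sum fun n _ => ?_
        rw [Real.dist_eq]
        exact pow_le_pow_left₀ (abs_nonneg _) (hM n) 2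
    _ = N * M ^ 2 := by simp
    _ ≤ (N * M) ^ 2 := by
        rw [mul_pow]
        gcongr
        nlinarith

/-- If every coordinate of `q` is within `max (u n) 0` of a point of the region, then the exponential
of the distance is dominated by a sum of exponentials. -/
theorem ofReal_exp_distRegion_le {r θ : ℝ} (hθ : 0 < θ) (hN : 0 < N) (q : Fin N → ℕ)
    {y : EuclideanSpace ℝ (Fin N)} (hy : y ∈ region N r) {u : Fin N → ℝ}
    (hu : ∀ n, |(q n : ℝ) - y n| ≤ max (u n) 0) :
    ENNReal.ofReal (Real.exp (θ / N * distRegion r q))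
      ≤ ∑ n, ENNReal.ofReal (Real.exp (max (θ * u n) 0)) := by
  obtain ⟨k, -, hk⟩ := Finset.exists_max_image Finset.univ (fun n => max (u n) 0)
    ⟨⟨0, hN⟩, Finset.mem_univ _⟩
  have hd : distRegion r q ≤ N * max (u k) 0 :=
    infDist_le_of_forall_abs_le hy hN fun n => (hu n).trans (hk n (Finset.mem_univ n))
  have hN0 : (0 : ℝ) < N := by exact_mod_cast hN
  refine le_trans (ENNReal.ofReal_le_ofReal (Real.exp_le_exp.2 ?_))
    (Finset.single_le_sum (f := fun n => ENNReal.ofReal (Real.exp (max (θ * u n) 0)))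
      (fun _ _ => zero_le) (Finset.mem_univ k))
  calc θ / N * distRegion r q ≤ θ / N * (N * max (u k) 0) := by gcongr
    _ = θ * max (u k) 0 := by field_simp
    _ = max (θ * u k) 0 := by rw [mul_max_of_nonneg _ _ hθ.le, mul_zero]

theorem ofReal_exp_distRegion_le_min {r θ : ℝ} (hr : 0 < r) (hθ : 0 < θ) (hN : 0 < N)
    (q : Fin N → ℕ) :
    ENNReal.ofReal (Real.exp (θ / N * distRegion r q)) ≤ min (lowerPot r θ q) (upperPot r θ q) := by
  refine le_min ?_ ?_
  · refine ofReal_exp_distRegion_le hθ hN q (y := WithLp.toLp 2 fun n => min (q n : ℝ) r)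
      (Or.inl fun n => ⟨le_min (Nat.cast_nonneg _) hr.le, min_le_right _ _⟩) fun n => ?_
    change |(q n : ℝ) - min (q n : ℝ) r| ≤ _
    rcases le_total (q n : ℝ) r with h | h
    · simp [min_eq_left h]
    · rw [min_eq_right h, abs_of_nonneg (by linarith)]
      exact le_max_left _ _
  · refine ofReal_exp_distRegion_le hθ hN q (y := WithLp.toLp 2 fun n => max (q n : ℝ) r)
      (Or.inr fun n => ⟨le_max_of_le_left (Nat.cast_nonneg _), le_max_right _ _⟩) fun n => ?_
    change |(q n : ℝ) - max (q n : ℝ) r| ≤ _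
    rcases le_total (q n : ℝ) r with h | h
    · rw [max_eq_right h, abs_of_nonpos (by linarith), neg_sub]
      exact le_max_left _ _
    · simp [max_eq_left h]

theorem finite_lowerPot_lt {r η : ℝ} (hη : 0 < η) (M : ℕ) :
    {z : State N | lowerPot r η z.1 < M}.Finite := by
  have hfin : ((Set.Iic fun _ : Fin N => ⌈M / η + r⌉₊) ×ˢ
      (Set.univ : Set (Finset (Fin N)))).Finite := (Set.finite_Iic _).prod Set.finite_univ
  refine hfin.subset fun z hz => ⟨fun n => ?_, Set.mem_univ _⟩
  have h1 : ENNReal.ofReal (Real.exp (max (η * (z.1 n - r)) 0)) < ENNReal.ofReal M := by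
    rw [ENNReal.ofReal_natCast]
    refine lt_of_le_of_lt ?_ (show lowerPot r η z.1 < M from hz)
    exact Finset.single_le_sum
      (f := fun n => ENNReal.ofReal (Real.exp (max (η * ((z.1 n : ℝ) - r)) 0)))
      (fun _ _ => zero_le) (Finset.mem_univ n)
  have h2 : Real.exp (max (η * (z.1 n - r)) 0) < M :=
    (ENNReal.ofReal_lt_ofReal_iff_of_nonneg (Real.exp_pos _).le).1 h1
  have h3 := Real.add_one_le_exp (max (η * (z.1 n - r)) 0)
  have h4 := le_max_left (η * (z.1 n - r)) 0
  have h5 : (z.1 n : ℝ) ≤ M / η + r := by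
    rw [← sub_le_iff_le_add, le_div_iff₀ hη, mul_comm]
    linarith
  exact_mod_cast h5.trans (Nat.le_ceil _)

/-- The level `a + k / (1 - ρ)` is preserved by the drift inequality `v ↦ ρ v + k`, for all
starting values `a ≥ 0`. -/
theorem ofReal_drift_fixed {ρ a k : ℝ} (hρ0 : 0 ≤ ρ) (hρ1 : ρ < 1) (ha : 0 ≤ a) (hk : 0 ≤ k) :
    ENNReal.ofReal ρ * ENNReal.ofReal (a + k / (1 - ρ)) + ENNReal.ofReal k
      ≤ ENNReal.ofReal (a + k / (1 - ρ)) := by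
  have h1 : 0 < 1 - ρ := by linarith
  have h2 : 0 ≤ k / (1 - ρ) := by positivity
  rw [← ENNReal.ofReal_mul hρ0, ← ENNReal.ofReal_add (by positivity) hk]
  refine ENNReal.ofReal_le_ofReal ?_
  have h3 : k / (1 - ρ) * (1 - ρ) = k := div_mul_cancel₀ _ h1.ne'
  nlinarith

theorem exists_pos_mul_le {D δ : ℝ} (hD : 0 < D) (hδ : 0 < δ) :
    ∃ θ : ℝ, 0 < θ ∧ θ * D ≤ 1 ∧ θ * D ≤ δ / 2 := by
  refine ⟨min 1 (δ / 2) / D, by positivity, ?_, ?_⟩ <;> rw [div_mul_cancel₀ _ hD.ne']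
  · exact min_le_left _ _
  · exact min_le_right _ _

end JBT

end

theorem proposition1 {N : ℕ} (F : JBT.Family N) (r : ℝ → ℝ)
    (hr : Tendsto r (𝓝[>] (0 : ℝ)) atTop) :
    ∃ ε₀ : ℝ, 0 < ε₀ ∧ ∃ θ : ℝ, 0 < θ ∧ ∃ C : ℝ, 0 < C ∧
      ∀ ε : ℝ, 0 < ε → ε < ε₀ →
        ∃ π : PMF (JBT.State N),
          F.IsSteadyState ε (r ε) π ∧
          (∀ π' : PMF (JBT.State N), F.IsSteadyState ε (r ε) π' → π' = π) ∧
          JBT.expMoment (r ε) θ π ≤ ENNReal.ofReal C := by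
  open JBT in
  have hN : (0 : ℝ) < N := by exact_mod_cast F.servers_pos
  obtain ⟨n₀, -, hn₀⟩ := Finset.exists_min_image Finset.univ F.rate
    ⟨⟨0, F.servers_pos⟩, Finset.mem_univ _⟩
  obtain ⟨b, hb, hbr, hbT⟩ : ∃ b : ℝ, 0 < b ∧ (∀ n, b ≤ F.rate n) ∧ b ≤ F.totalRate :=
    ⟨F.rate n₀, F.rate_pos n₀, fun n => hn₀ n (Finset.mem_univ n), F.rate_le_totalRate n₀⟩
  have hT : 0 < F.totalRate := hb.trans_le hbT
  obtain ⟨e, he, hre⟩ := mem_nhdsGT_iff_exists_Ioo_subset.1 (hr (Ioi_mem_atTop 0))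
  obtain ⟨θ, hθ, hθ1, hθ2⟩ := exists_pos_mul_le F.inputBound_pos
    (show 0 < b ^ 2 / (2 * F.totalRate) by positivity)
  have hk : 0 ≤ N * F.driftConst := by unfold Family.driftConst; positivity
  set ρ := Real.exp (-(θ * (b ^ 2 / (2 * F.totalRate)) / 2)) with hρ
  have hρ1 : ρ < 1 := Real.exp_lt_one_iff.2 (neg_neg_of_pos (by positivity))
  have hC : 0 < N + N * F.driftConst / (1 - ρ) :=
    add_pos_of_pos_of_nonneg hN (div_nonneg hk (by linarith))
  refine ⟨min e (b / 2), lt_min he (by positivity), θ / N, by positivity, _, hC,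
    fun ε hε hε₀ => ?_⟩
  have hrε : 0 < r ε := hre ⟨hε, hε₀.trans_le (min_le_left _ _)⟩
  have hεb : ε ≤ b / 2 := hε₀.le.trans (min_le_right _ _)
  have hεμ : ε < F.totalRate := by linarith
  obtain ⟨η, hη, hη1, hη2⟩ := exists_pos_mul_le F.inputBound_pos
    (show 0 < ε * (b / F.totalRate) by positivity)
  have hz := emptyState_mem (N := N) hrε
  have hclosed := F.consistent_closed ε (r ε)
  obtain ⟨π, hπ, hmom⟩ := exists_invariant (P := F.step ε (r ε)) ENNReal.ofReal_ne_top
    (finite_lowerPot_lt (r := r ε) hη) (lmean_lawAt_le hz hclosed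
      (fun z hz => F.drift_lowerPot hε hεμ hrε hb hbr hη hη1 hη2 hz)
      (ofReal_drift_fixed (Real.exp_pos _).le
        (Real.exp_lt_one_iff.2 (neg_neg_of_pos (by positivity))) hN.le hk)
      (by
        rw [lowerPot_emptyState hrε hη]
        refine ENNReal.ofReal_le_ofReal (le_add_of_nonneg_right (div_nonneg hk ?_))
        rw [sub_nonneg, Real.exp_le_one_iff, neg_nonpos]
        positivity))
  refine ⟨π, hπ, fun π' hπ' => invariant_unique (F.reaches_emptyState hε hεμ hrε) hπ' hπ, ?_⟩
  refine le_trans (lmean_mono fun z => ofReal_exp_distRegion_le_min hrε hθ F.servers_pos z.1)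
    (hmom _ _ (fun z => ne_top_of_le_ne_top (lowerPot_ne_top _ _ _) (min_le_left _ _))
      (lmean_lawAt_le hz hclosed
        (fun z hz => F.drift_min hε hεb hrε hb hbr hθ hθ1 hθ2 hz)
        (ofReal_drift_fixed (Real.exp_pos _).le hρ1 hN.le hk) ?_))
  refine (min_le_left _ _).trans ?_
  rw [lowerPot_emptyState hrε hθ]
  exact ENNReal.ofReal_le_ofReal (le_add_of_nonneg_right (div_nonneg hk (by linarith)))
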